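/- Let $n\ge 0$ be an integer and let $\lambda=(\lambda_1\ge\cdots\ge\lambda_n\ge 0)$ and $\mu=(\mu_1\ge\cdots\ge\mu_n\ge 0)$ be integer partitions with at most $n$ parts. Let $s_\lambda(x_1,\dots,x_n)$ denote the Schur polynomial, i.e. the polynomial $$s_\lambda(x_1,\dots,x_n)=\frac{\det\bigl[x_i^{\lambda_j+n-j}\bigr]_{i,j=1}^n}{\det\bigl[x_i^{n-j}\bigr]_{i,j=1}^n},$$ and let $S_\lambda(x)=s_\lambda(x_1,\dots,x_n)/s_\lambda(1,\dots,1)$ be the normalized Schur function. Suppose that $\lambda$ is majorized by $\mu$ ($\lambda\prec\mu$), i.e. $\sum_{i=1}^k\lambda_i\le\sum_{i=1}^k\mu_i$ for $1\le k\le n-1$ and $\sum_{i=1}^n\lambda_i=\sum_{i=1}^n\mu_i$. Then, for all real $x_1,\dots,x_n\ge 0$, $$S_\lambda(x_1,\dots,x_n)\le S_\mu(x_1,\dots,x_n).$$ -/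

import Mathlib

namespace NormalizedSchur

open MvPolynomial

/-- The alternant `det (X_i ^ e_j)` in the variables `X_0, …, X_{n-1}`. -/
noncomputable def alternant {n : ℕ} (e : Fin n → ℕ) : MvPolynomial (Fin n) ℝ :=
  Matrix.det (Matrix.of fun i j : Fin n => (X i : MvPolynomial (Fin n) ℝ) ^ e j)

/-- The staircase exponents `(n-1, n-2, …, 0)`. -/
def staircase (n : ℕ) (j : Fin n) : ℕ := n - 1 - (j : ℕ)

theorem alternant_staircase (n : ℕ) :
    alternant (staircase n) = ∏ i : Fin n, ∏ j ∈ Finset.Ioi i,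
      ((X i : MvPolynomial (Fin n) ℝ) - X j) := by
  have h := Matrix.det_projVandermonde (fun _ : Fin n => (1 : MvPolynomial (Fin n) ℝ))
    (fun i => X i)
  simp only [one_mul] at h
  rw [← h, alternant]
  congr 1
  ext1 i j
  simp only [Matrix.of_apply, Matrix.projVandermonde_apply, one_pow, one_mul, staircase,
    Fin.val_rev]
  congr 1
  omega

theorem X_sub_X_dvd_iff {n : ℕ} (i j : Fin n) (p : MvPolynomial (Fin n) ℝ) :
    (X i - X j : MvPolynomial (Fin n) ℝ) ∣ p ↔
      aeval (Function.update (X : Fin n → MvPolynomial (Fin n) ℝ) i (X j)) p = 0 := by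
  set f := aeval (R := ℝ) (Function.update (X : Fin n → MvPolynomial (Fin n) ℝ) i (X j)) with hf
  have key : ∀ q : MvPolynomial (Fin n) ℝ, (X i - X j : MvPolynomial (Fin n) ℝ) ∣ q - f q := by
    intro q
    induction q using MvPolynomial.induction_on with
    | C a => simp [hf]
    | add p q hp hq =>
      rw [map_add, add_sub_add_comm]
      exact dvd_add hp hq
    | mul_X p k hp =>
      have hk : (X i - X j : MvPolynomial (Fin n) ℝ) ∣ X k - f (X k) := by
        by_cases h : k = i
        · subst h; simp [hf]
        · simp [hf, Function.update_of_ne h]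
      have : p * X k - f (p * X k) = (p - f p) * X k + f p * (X k - f (X k)) := by
        rw [map_mul]; ring
      rw [this]
      exact dvd_add (hp.mul_right _) (hk.mul_left _)
  constructor
  · rintro ⟨r, rfl⟩
    rw [map_mul, map_sub]
    by_cases h : j = i
    · subst h; simp
    · simp [hf, Function.update_of_ne h]
  · intro h
    simpa [h] using key p

theorem X_sub_X_prime {n : ℕ} {i j : Fin n} (h : i ≠ j) :
    Prime (X i - X j : MvPolynomial (Fin n) ℝ) := by
  refine ⟨fun h0 => h (X_injective (sub_eq_zero.mp h0)), fun hu => ?_, fun a b hab => ?_⟩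
  · have := (X_sub_X_dvd_iff i j 1).mp (hu.dvd)
    simp at this
  · simpa only [X_sub_X_dvd_iff, map_mul, mul_eq_zero] using hab

/-- Every alternant is divisible by the Vandermonde determinant. -/
theorem alternant_staircase_dvd {n : ℕ} (e : Fin n → ℕ) :
    alternant (staircase n) ∣ alternant e := by
  classical
  rw [alternant_staircase, Finset.prod_sigma']
  have hlt : ∀ a ∈ (Finset.univ : Finset (Fin n)).sigma (fun i => Finset.Ioi i),
      a.1 < a.2 := by
    intro a ha
    simpa using ha
  have hd : ∀ a ∈ (Finset.univ : Finset (Fin n)).sigma (fun i => Finset.Ioi i),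
      ∀ b ∈ (Finset.univ : Finset (Fin n)).sigma (fun i => Finset.Ioi i),
        (X a.1 - X a.2 : MvPolynomial (Fin n) ℝ) ∣ X b.1 - X b.2 → a = b := by
    rintro ⟨i, j⟩ ha ⟨k, l⟩ hb hdvd
    have h1 : i < j := hlt _ ha
    have h2 : k < l := hlt _ hb
    rw [X_sub_X_dvd_iff] at hdvd
    simp only [map_sub, aeval_X, sub_eq_zero, Function.update_apply] at hdvd
    split_ifs at hdvd with h3 h4 h4
    · omega
    · have := X_injective hdvd
      subst h3; subst this; rfl
    · have := X_injective hdvd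
      omega
    · have := X_injective hdvd
      omega
  refine Finset.prod_dvd_of_isRelPrime (fun a ha b hb hab => ?_) fun a ha => ?_
  · refine (X_sub_X_prime (hlt a ha).ne).irreducible.isRelPrime_iff_not_dvd.mpr fun h => ?_
    exact hab (hd a ha b hb h)
  · rw [X_sub_X_dvd_iff, alternant, AlgHom.map_det]
    have hne := (hlt a ha).ne
    refine Matrix.det_zero_of_row_eq hne ?_
    funext k
    simp [Function.update_of_ne hne.symm]

theorem alternant_staircase_ne_zero (n : ℕ) : alternant (staircase n) ≠ 0 := by
  rw [alternant_staircase]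
  refine Finset.prod_ne_zero_iff.mpr fun i _ => Finset.prod_ne_zero_iff.mpr fun j hj => ?_
  exact (X_sub_X_prime (Finset.mem_Ioi.mp hj).ne).ne_zero

/-- The Schur polynomial `s_lam` in `n` variables: the quotient of the alternants
`det (X_i ^ (lam_j + n - j))` and `det (X_i ^ (n - j))` (with `j` running from `1` to `n`), as a
polynomial; this quotient exists and is unique, see `schur_mul_alternant`. -/
noncomputable def schur {n : ℕ} (lam : Fin n → ℕ) : MvPolynomial (Fin n) ℝ :=
  Classical.choose (alternant_staircase_dvd fun j => lam j + staircase n j)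

theorem schur_mul_alternant {n : ℕ} (lam : Fin n → ℕ) :
    schur lam * alternant (staircase n) = alternant fun j => lam j + staircase n j := by
  rw [mul_comm]
  exact (Classical.choose_spec (alternant_staircase_dvd fun j => lam j + staircase n j)).symm

theorem eval_alternant {n : ℕ} (e : Fin n → ℕ) (x : Fin n → ℝ) :
    eval x (alternant e) = Matrix.det (Matrix.of fun i j : Fin n => x i ^ e j) := by
  rw [alternant, RingHom.map_det]
  congr 1
  ext i j
  simp

/-- At pairwise distinct arguments, the Schur polynomial is the quotient of determinants. -/
theorem eval_schur {n : ℕ} (lam : Fin n → ℕ) {x : Fin n → ℝ} (hx : Function.Injective x) :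
    eval x (schur lam) =
      Matrix.det (Matrix.of fun i j : Fin n => x i ^ (lam j + (n - 1 - (j : ℕ)))) /
        Matrix.det (Matrix.of fun i j : Fin n => x i ^ (n - 1 - (j : ℕ))) := by
  have h0 : eval x (alternant (staircase n)) ≠ 0 := by
    rw [alternant_staircase, map_prod]
    refine Finset.prod_ne_zero_iff.mpr fun i _ => ?_
    rw [map_prod]
    refine Finset.prod_ne_zero_iff.mpr fun j hj => ?_
    have := (Finset.mem_Ioi.mp hj).ne
    simpa [sub_eq_zero] using hx.ne this
  have h := congrArg (eval x) (schur_mul_alternant lam)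
  rw [map_mul, eval_alternant fun j => lam j + staircase n j] at h
  rw [eval_alternant] at h h0
  exact (eq_div_iff h0).mpr h

theorem aeval_alternant_powers {n : ℕ} (e : Fin n → ℕ) :
    aeval (fun i : Fin n => (Polynomial.X : Polynomial ℝ) ^ (i : ℕ)) (alternant e) =
      ∏ i : Fin n, ∏ j ∈ Finset.Ioi i, ((Polynomial.X : Polynomial ℝ) ^ e j -
        Polynomial.X ^ e i) := by
  rw [← Matrix.det_vandermonde, ← Matrix.det_transpose, alternant, AlgHom.map_det]
  congr 1
  ext1 i j
  simp [Matrix.vandermonde_apply, ← pow_mul, mul_comm]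

theorem prod_powers_sub {n : ℕ} {e : Fin n → ℕ} (he : StrictAnti e) :
    ∃ g : Polynomial ℝ, 0 < g.eval 1 ∧
      ∏ i : Fin n, ∏ j ∈ Finset.Ioi i, ((Polynomial.X : Polynomial ℝ) ^ e j -
        Polynomial.X ^ e i) =
      (∏ i : Fin n, ∏ _j ∈ Finset.Ioi i, ((1 : Polynomial ℝ) - Polynomial.X)) * g := by
  refine ⟨∏ i : Fin n, ∏ j ∈ Finset.Ioi i, ((Polynomial.X : Polynomial ℝ) ^ e j *
    ∑ k ∈ Finset.range (e i - e j), Polynomial.X ^ k), ?_, ?_⟩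
  · simp only [Polynomial.eval_prod]
    refine Finset.prod_pos fun i _ => Finset.prod_pos fun j hj => ?_
    have := he (Finset.mem_Ioi.mp hj)
    simp [Polynomial.eval_finsetSum, this]
  · simp only [← Finset.prod_mul_distrib]
    refine Finset.prod_congr rfl fun i _ => Finset.prod_congr rfl fun j hj => ?_
    have := he (Finset.mem_Ioi.mp hj)
    have h1 := mul_neg_geom_sum (Polynomial.X : Polynomial ℝ) (e i - e j)
    have h2 : (Polynomial.X : Polynomial ℝ) ^ e i =
        Polynomial.X ^ e j * Polynomial.X ^ (e i - e j) := by
      rw [← pow_add]; congr 1; omega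
    rw [mul_left_comm, h1, h2]
    ring

/-- For a partition `lam`, the number `s_lam (1, …, 1)` is positive. -/
theorem eval_one_schur_pos {n : ℕ} {lam : Fin n → ℕ} (hlam : Antitone lam) :
    0 < eval (1 : Fin n → ℝ) (schur lam) := by
  have hst : StrictAnti (staircase n) := by
    intro i j h
    have := j.isLt
    have : (i : ℕ) < j := h
    simp only [staircase]
    omega
  obtain ⟨g, hg, hg'⟩ := prod_powers_sub hst
  obtain ⟨f, hf, hf'⟩ := prod_powers_sub (hlam.add_strictAnti hst)
  have h := congrArg (aeval (fun i : Fin n => (Polynomial.X : Polynomial ℝ) ^ (i : ℕ)))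
    (schur_mul_alternant lam)
  rw [map_mul, aeval_alternant_powers, aeval_alternant_powers, hg'] at h
  rw [hf', mul_left_comm] at h
  have hne : ∏ i : Fin n, ∏ _j ∈ Finset.Ioi i, ((1 : Polynomial ℝ) - Polynomial.X) ≠ 0 := by
    refine Finset.prod_ne_zero_iff.mpr fun i _ => Finset.prod_ne_zero_iff.mpr fun j hj => ?_
    intro h0
    have := congrArg (Polynomial.eval 0) h0
    simp at this
  have h2 := congrArg (Polynomial.eval 1) (mul_left_cancel₀ hne h)
  rw [Polynomial.eval_mul] at h2
  have h3 : Polynomial.eval 1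
      (aeval (fun i : Fin n => (Polynomial.X : Polynomial ℝ) ^ (i : ℕ)) (schur lam)) =
      eval (1 : Fin n → ℝ) (schur lam) := by
    have h4 : (Polynomial.evalRingHom (1 : ℝ)).comp
        (aeval (R := ℝ) fun i : Fin n => (Polynomial.X : Polynomial ℝ) ^ (i : ℕ)).toRingHom =
        eval (1 : Fin n → ℝ) := by
      apply MvPolynomial.ringHom_ext <;> intro r <;> simp
    exact congrArg (fun f : MvPolynomial (Fin n) ℝ →+* ℝ => f (schur lam)) h4
  rw [h3] at h2
  exact pos_of_mul_pos_left (h2 ▸ hf) hg.le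

/-- The normalized Schur function `S_lam (x) = s_lam (x) / s_lam (1, …, 1)`. -/
noncomputable def normalizedSchur {n : ℕ} (lam : Fin n → ℕ) (x : Fin n → ℝ) : ℝ :=
  eval x (schur lam) / eval (1 : Fin n → ℝ) (schur lam)

/-- `a ≺ b` (`a` is majorized by `b`), for decreasingly ordered `n`-tuples: the partial sums of
`a` are at most those of `b`, and the total sums are equal. -/
def Majorized {n : ℕ} (a b : Fin n → ℝ) : Prop :=
  (∀ k : ℕ, 1 ≤ k → k ≤ n - 1 →
    ∑ i ∈ Finset.univ.filter (fun i : Fin n => (i : ℕ) < k), a i ≤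
      ∑ i ∈ Finset.univ.filter (fun i : Fin n => (i : ℕ) < k), b i) ∧
  ∑ i, a i = ∑ i, b i

end NormalizedSchur

/-! For `x_i = exp (a_i)` with `a` strictly decreasing and `l = lam + staircase`, the numerator of
`s_lam` is `det (exp (a_i l_j))`. By the Harish-Chandra–Itzykson–Zuber formula
(`det_exp_eq_orbitalIntegral`) it is the Vandermonde product of `l` times an integral of `exp ⟨l,
v⟩` against a positive measure depending only on `a`. The Weyl dimension formula (`eval_one_schur`)
puts the same Vandermonde product into `s_lam (1, …, 1)`, so it cancels: `S_lam` is the integral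
times a nonnegative factor independent of `lam` (`normalizedSchur_exp`).

The integral is convex in `l` and symmetric at distinct entries, hence monotone under majorization,
which survives adding the staircase. Continuity gives all `x ≥ 0`. -/

namespace NormalizedSchur

open MeasureTheory

/-! ### Majorization and convex hulls of rearrangements. -/

/-- Abel summation: the boundary term vanishes with the total, and what remains pairs the gaps `d i
- d (i + 1) ≥ 0` with partial sums of `z`. -/
theorem sum_mul_nonneg_of_partial_sums {n : ℕ} {d z : Fin n → ℝ} (hd : Antitone d)
    (hz : ∀ k : ℕ, 1 ≤ k → k ≤ n - 1 →
      0 ≤ ∑ i ∈ Finset.univ.filter (fun i : Fin n => (i : ℕ) < k), z i)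
    (hz' : ∑ i, z i = 0) : 0 ≤ ∑ i, d i * z i := by
  set D : ℕ → ℝ := fun i => if h : i < n then d ⟨i, h⟩ else 0 with hD
  set Z : ℕ → ℝ := fun i => if h : i < n then z ⟨i, h⟩ else 0 with hZ
  have hDi : ∀ i : Fin n, D i = d i := fun i => by simp [hD]
  have hZi : ∀ i : Fin n, Z i = z i := fun i => by simp [hZ]
  have hpart : ∀ k ≤ n, ∑ i ∈ Finset.range k, Z i =
      ∑ i ∈ Finset.univ.filter (fun i : Fin n => (i : ℕ) < k), z i := by
    intro k hk
    rw [Finset.sum_filter]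
    have h1 : ∀ i : Fin n, (if (i : ℕ) < k then z i else 0) =
        (fun i : ℕ => if i < k then Z i else 0) i := fun i => by simp [hZi]
    simp_rw [h1]
    rw [Fin.sum_univ_eq_sum_range (fun i : ℕ => if i < k then Z i else 0) n,
      ← Finset.sum_filter]
    congr 1
    ext i
    simp only [Finset.mem_range, Finset.mem_filter]
    omega
  have htot : ∑ i ∈ Finset.range n, Z i = 0 := by
    rw [← Fin.sum_univ_eq_sum_range Z n]
    simpa [hZi] using hz'
  have h2 : ∑ i, d i * z i = ∑ i ∈ Finset.range n, D i • Z i := by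
    rw [← Fin.sum_univ_eq_sum_range (fun i => D i • Z i) n]
    simp [hDi, hZi]
  rw [h2, Finset.sum_range_by_parts, htot, smul_zero, zero_sub, ← Finset.sum_neg_distrib]
  refine Finset.sum_nonneg fun i hi => ?_
  rw [Finset.mem_range] at hi
  rw [← neg_smul, smul_eq_mul]
  refine mul_nonneg ?_ ?_
  · have hi0 : i < n := by omega
    have hi1 : i + 1 < n := by omega
    have := hd (show (⟨i, hi0⟩ : Fin n) ≤ ⟨i + 1, hi1⟩ from Nat.le_succ i)
    simp only [hD, hi0, hi1, dif_pos]
    linarith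
  · rw [hpart _ (by omega)]
    exact hz _ (by omega) (by omega)

/-- A decreasing vector majorized by a decreasing vector `y` lies in the convex hull of the
rearrangements of `y`. -/
theorem Majorized.mem_convexHull {n : ℕ} {x y : Fin n → ℝ} (hx : Antitone x)
    (h : Majorized x y) :
    x ∈ convexHull ℝ (Set.range fun σ : Equiv.Perm (Fin n) => y ∘ σ) := by
  by_contra hmem
  have hclosed := ((Set.finite_range
    fun σ : Equiv.Perm (Fin n) => y ∘ σ).isCompact_convexHull (𝕜 := ℝ)).isClosed
  obtain ⟨f, u, hu, hux⟩ := geometric_hahn_banach_closed_point (convex_convexHull ℝ _) hclosed hmem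
  set c : Fin n → ℝ := fun i => f (Pi.single i 1) with hc
  have hf : ∀ v, f v = ∑ i, c i * v i := by
    intro v
    conv_lhs => rw [← Finset.univ_sum_single v]
    rw [map_sum]
    refine Finset.sum_congr rfl fun i _ => ?_
    rw [show (Pi.single i (v i) : Fin n → ℝ) = v i • Pi.single i 1 by
      rw [← Pi.single_smul]; simp, map_smul, smul_eq_mul, mul_comm]
  -- Sorting `-c` puts `c` in decreasing order. Rearrangement (`h1`) and Abel summation (`h2`) then
  -- bound `f x` by `f` at a rearrangement of `y`, against the separation.
  set σ := Tuple.sort (fun i => - c i) with hσ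
  have hanti : Antitone (c ∘ σ) := by
    intro i j hij
    have := Tuple.monotone_sort (fun i => - c i) hij
    simpa using this
  have h1 : ∑ i, c i * x i ≤ ∑ i, c (σ i) * x i := by
    have hm : Monovary (c ∘ σ) x := hanti.monovary hx
    have := hm.sum_comp_perm_mul_le_sum_mul (σ := σ⁻¹)
    simpa using this
  have h2 : ∑ i, c (σ i) * x i ≤ ∑ i, c (σ i) * y i := by
    have := sum_mul_nonneg_of_partial_sums (z := fun i => y i - x i) hanti
      (fun k hk hk' => by simpa [Finset.sum_sub_distrib] using h.1 k hk hk')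
      (by simp [Finset.sum_sub_distrib, h.2])
    simp only [mul_sub, Finset.sum_sub_distrib, Function.comp_apply] at this
    linarith
  have h3 : ∑ i, c (σ i) * y i = f (y ∘ ⇑σ⁻¹) := by
    rw [hf, ← Equiv.sum_comp σ (fun i => c i * (y ∘ ⇑σ⁻¹) i)]
    simp
  have h4 := hu _ (subset_convexHull ℝ _ ⟨σ⁻¹, rfl⟩)
  rw [hf] at hux
  simp only at h4
  linarith

/-! ### The orbital integral and its convexity. -/

/-- The point with coordinates `a_{i+1} + t_i (a_i - a_{i+1})`, which interlaces with `a`. -/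
noncomputable def interlace {n : ℕ} (a : Fin (n + 1) → ℝ) (t : Fin n → unitInterval) :
    Fin n → ℝ :=
  fun i => a i.succ + t i * (a i.castSucc - a i.succ)

theorem antitone_interlace {n : ℕ} {a : Fin (n + 1) → ℝ} (ha : Antitone a)
    (t : Fin n → unitInterval) : Antitone (interlace a t) := by
  intro i j hij
  rcases hij.eq_or_lt with rfl | hij
  · rfl
  have h1 := ha (Fin.castSucc_lt_succ (i := i)).le
  have h2 := ha (Fin.castSucc_lt_succ (i := j)).le
  have h3 : a j.castSucc ≤ a i.succ := ha (Fin.succ_le_castSucc_iff.mpr hij)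
  have := (t i).2.1
  have := (t j).2.2
  simp only [interlace]
  nlinarith

theorem continuous_interlace {n : ℕ} :
    Continuous fun p : (Fin (n + 1) → ℝ) × (Fin n → unitInterval) => interlace p.1 p.2 := by
  unfold interlace
  fun_prop

/-- The integral of the exponentials `exp ⟨l, v⟩`, with `v` the weight of a real Gelfand–Tsetlin
pattern with top row `a`. -/
noncomputable def orbitalIntegral : (n : ℕ) → (Fin n → ℝ) → (Fin n → ℝ) → ℝ
  | 0, _, _ => 1
  -- The product is the Jacobian from the unit cube to the box of rows interlacing with `a`.
  | n + 1, a, l => (∏ i : Fin n, (a i.castSucc - a i.succ)) *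
      ∫ t : Fin n → unitInterval, Real.exp (l 0 * (∑ i, a i - ∑ i, interlace a t i)) *
        orbitalIntegral n (interlace a t) (Fin.tail l)

theorem continuous_orbitalIntegral (n : ℕ) (l : Fin n → ℝ) :
    Continuous fun a => orbitalIntegral n a l := by
  induction n with
  | zero => exact continuous_const
  | succ n ih =>
    unfold orbitalIntegral
    refine Continuous.mul (by fun_prop) ?_
    have := continuous_parametric_integral_of_continuous (μ := volume)
      (f := fun (a : Fin (n + 1) → ℝ) (t : Fin n → unitInterval) =>
        Real.exp (l 0 * (∑ i, a i - ∑ i, interlace a t i)) *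
        orbitalIntegral n (interlace a t) (Fin.tail l)) ?_ isCompact_univ
    · simpa only [Measure.restrict_univ] using this
    · refine Continuous.mul ?_ ((ih (Fin.tail l)).comp continuous_interlace)
      have h : ∀ i, Continuous fun p : (Fin (n + 1) → ℝ) × (Fin n → unitInterval) =>
          interlace p.1 p.2 i := fun i => (continuous_apply i).comp continuous_interlace
      fun_prop

/-- Products of convex functions need not be convex, so the induction carries the factor `exp p.1`:
it absorbs the exponential of the linear form in `l` from the recursion. Each integrand is then the
previous case composed with a linear map. -/
theorem convexOn_exp_mul_orbitalIntegral (n : ℕ) {a : Fin n → ℝ} (ha : Antitone a) :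
    ConvexOn ℝ Set.univ fun p : ℝ × (Fin n → ℝ) =>
      Real.exp p.1 * orbitalIntegral n a p.2 := by
  induction n with
  | zero =>
    simp only [orbitalIntegral, mul_one]
    exact convexOn_exp.comp_linearMap (LinearMap.fst ℝ ℝ (Fin 0 → ℝ))
  | succ n ih =>
    have hP : 0 ≤ ∏ i : Fin n, (a i.castSucc - a i.succ) := Finset.prod_nonneg fun i _ =>
      sub_nonneg.mpr (ha (Fin.castSucc_lt_succ (i := i)).le)
    set G : (ℝ × (Fin (n + 1) → ℝ)) → (Fin n → unitInterval) → ℝ := fun p t =>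
      Real.exp (p.1 + p.2 0 * (∑ i, a i - ∑ i, interlace a t i)) *
        orbitalIntegral n (interlace a t) (Fin.tail p.2) with hG
    have hcont : ∀ p, Continuous (G p) := by
      intro p
      have h0 : Continuous (interlace a) :=
        continuous_interlace.comp (Continuous.prodMk_right a)
      have h : ∀ i, Continuous fun t => interlace a t i := fun i => (continuous_apply i).comp h0
      have := (continuous_orbitalIntegral n (Fin.tail p.2)).comp h0
      refine Continuous.mul (by fun_prop) this
    have hint : ∀ p, Integrable (G p) := fun p =>
      (hcont p).integrable_of_hasCompactSupport (HasCompactSupport.of_compactSpace _)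
    have hGc : ∀ t, ConvexOn ℝ Set.univ fun p => G p t := by
      intro t
      let φ : (ℝ × (Fin (n + 1) → ℝ)) →ₗ[ℝ] ℝ × (Fin n → ℝ) :=
        { toFun := fun p => (p.1 + p.2 0 * (∑ i, a i - ∑ i, interlace a t i), Fin.tail p.2)
          map_add' := fun p q => by
            ext <;> simp [Fin.tail]
            ring
          map_smul' := fun c p => by
            ext <;> simp [Fin.tail]
            ring }
      exact (ih (antitone_interlace ha t)).comp_linearMap φ
    have heq : (fun p : ℝ × (Fin (n + 1) → ℝ) => Real.exp p.1 * orbitalIntegral (n + 1) a p.2) =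
        fun p => (∏ i : Fin n, (a i.castSucc - a i.succ)) • ∫ t, G p t := by
      funext p
      simp only [orbitalIntegral, hG, Real.exp_add, mul_assoc, smul_eq_mul, integral_const_mul]
      ring
    rw [heq]
    refine ConvexOn.smul hP ⟨convex_univ, fun p _ q _ s r hs hr hsr => ?_⟩
    have h1 := integral_mono (hint (s • p + r • q))
      (((hint p).smul s).add ((hint q).smul r))
      (fun t => (hGc t).2 (Set.mem_univ p) (Set.mem_univ q) hs hr hsr)
    refine h1.trans_eq ?_
    refine (integral_add ((hint p).smul s) ((hint q).smul r)).trans ?_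
    simp only [Pi.smul_apply, integral_smul]

theorem convexOn_orbitalIntegral {n : ℕ} {a : Fin n → ℝ} (ha : Antitone a) :
    ConvexOn ℝ Set.univ (orbitalIntegral n a) := by
  have := (convexOn_exp_mul_orbitalIntegral n ha).comp_linearMap
    (LinearMap.inr ℝ ℝ (Fin n → ℝ))
  simpa [Function.comp_def] using this

/-! ### The determinant formula and Schur convexity. -/

theorem integral_unitInterval_exp (u v d : ℝ) :
    (v - u) * d * ∫ t : unitInterval, Real.exp ((u + t * (v - u)) * d) =
      Real.exp (v * d) - Real.exp (u * d) := by
  have h1 : ∫ t : unitInterval, Real.exp ((u + t * (v - u)) * d) =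
      ∫ t in (0 : ℝ)..1, Real.exp ((u + t * (v - u)) * d) := by
    rw [intervalIntegral.integral_of_le zero_le_one, ← integral_Icc_eq_integral_Ioc]
    exact integral_subtype_comap measurableSet_Icc
      fun t : ℝ => Real.exp ((u + t * (v - u)) * d)
  have h2 : ∀ t ∈ Set.uIcc (0 : ℝ) 1, HasDerivAt (fun t => Real.exp ((u + t * (v - u)) * d))
      ((v - u) * d * Real.exp ((u + t * (v - u)) * d)) t := by
    intro t _
    have := ((((hasDerivAt_id t).mul_const (v - u)).const_add u).mul_const d).exp
    refine this.congr_deriv ?_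
    simp only [id]
    ring
  rw [h1, ← intervalIntegral.integral_const_mul,
    intervalIntegral.integral_eq_sub_of_hasDerivAt h2
      (Continuous.intervalIntegrable (by fun_prop) _ _)]
  congr 3 <;> ring

/-- The integral of a determinant whose rows depend on independent variables. -/
theorem det_integral_eq_integral_det {n : ℕ} {f : Fin n → Fin n → unitInterval → ℝ}
    (hf : ∀ i j, Continuous (f i j)) :
    Matrix.det (Matrix.of fun i j => ∫ t, f i j t) =
      ∫ t : Fin n → unitInterval, Matrix.det (Matrix.of fun i j => f i j (t i)) := by
  -- After transposing, the factors of each Leibniz term are indexed by rows, so each depends on its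
  -- own `t i` and Fubini applies.
  simp only [← Matrix.det_transpose (Matrix.of _)]
  simp only [Matrix.det_apply', Matrix.transpose_apply, Matrix.of_apply]
  rw [integral_finsetSum]
  · refine Finset.sum_congr rfl fun σ _ => ?_
    rw [integral_const_mul, integral_fintype_prod_volume_eq_prod]
  · intro σ _
    refine Continuous.integrable_of_hasCompactSupport ?_ (HasCompactSupport.of_compactSpace _)
    fun_prop

theorem det_exp_sub {n : ℕ} (a l : Fin n → ℝ) (c : ℝ) :
    Matrix.det (Matrix.of fun i j => Real.exp (a i * (l j - c))) =
      Real.exp (- (c * ∑ i, a i)) * Matrix.det (Matrix.of fun i j => Real.exp (a i * l j)) := by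
  have := Matrix.det_mul_column (fun i => Real.exp (- (c * a i)))
    (Matrix.of fun i j => Real.exp (a i * l j))
  rw [← Real.exp_sum, Finset.sum_neg_distrib, ← Finset.mul_sum] at this
  rw [← this]
  congr 1
  ext i j
  simp only [Matrix.of_apply, ← Real.exp_add]
  congr 1
  ring

theorem det_eq_det_sub_rows {n : ℕ} (M : Matrix (Fin (n + 1)) (Fin (n + 1)) ℝ)
    (hM : ∀ i, M i 0 = 1) :
    M.det = Matrix.det (Matrix.of fun i j : Fin n =>
      M i.succ j.succ - M i.castSucc j.succ) := by
  rw [Matrix.det_eq_of_forall_row_eq_smul_add_pred (A := M)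
    (B := Matrix.of fun i j => Fin.cases (M 0 j)
      (fun i : Fin n => M i.succ j - M i.castSucc j) i) (fun _ => 1) (by simp) (by simp),
    Matrix.det_succ_column_zero, Fin.sum_univ_succ]
  simp only [Matrix.of_apply, Fin.cases_succ, Fin.cases_zero, hM, sub_self, mul_zero, zero_mul,
    Finset.sum_const_zero, add_zero, Fin.val_zero, pow_zero, one_mul]
  congr 1

/-- A form of the Harish-Chandra–Itzykson–Zuber formula. -/
theorem det_exp_eq_orbitalIntegral (n : ℕ) (a l : Fin n → ℝ) :
    Matrix.det (Matrix.of fun i j => Real.exp (a i * l j)) =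
      (∏ i, ∏ j ∈ Finset.Ioi i, (l i - l j)) * orbitalIntegral n a l := by
  induction n with
  | zero => simp [orbitalIntegral]
  | succ n ih =>
    -- Shifting all exponents by `l 0` makes column `0` constant `1`, so row differences reduce the
    -- size by one.
    set d : Fin n → ℝ := fun j => l j.succ - l 0 with hd
    have h1 : Matrix.det (Matrix.of fun i j => Real.exp (a i * l j)) =
        Real.exp (l 0 * ∑ i, a i) *
          Matrix.det (Matrix.of fun i j => Real.exp (a i * (l j - l 0))) := by
      rw [det_exp_sub, ← mul_assoc, ← Real.exp_add, add_neg_cancel, Real.exp_zero, one_mul]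
    -- The row factors give the Jacobian, the column factors the part of the Vandermonde product
    -- involving `l 0`.
    have h2 : (Matrix.of fun i j : Fin n => Real.exp (a i.succ * (l j.succ - l 0)) -
        Real.exp (a i.castSucc * (l j.succ - l 0))) =
        Matrix.of fun i j : Fin n => (a i.castSucc - a i.succ) *
          (Matrix.of fun i j : Fin n => (l 0 - l j.succ) * (Matrix.of fun i j : Fin n =>
            ∫ t : unitInterval, Real.exp
              ((a i.succ + t * (a i.castSucc - a i.succ)) * d j)) i j) i j := by
      ext i j
      have := integral_unitInterval_exp (a i.succ) (a i.castSucc) (d j)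
      simp only [Matrix.of_apply, hd] at this ⊢
      linear_combination this
    have h3 : ∀ t : Fin n → unitInterval, Matrix.det (Matrix.of fun i j : Fin n =>
        Real.exp ((a i.succ + t i * (a i.castSucc - a i.succ)) * d j)) =
        Real.exp (- (l 0 * ∑ i, interlace a t i)) *
          ((∏ i, ∏ j ∈ Finset.Ioi i, (Fin.tail l i - Fin.tail l j)) *
            orbitalIntegral n (interlace a t) (Fin.tail l)) := by
      intro t
      rw [← ih, ← det_exp_sub]
      rfl
    rw [h1, det_eq_det_sub_rows _ (by simp)]
    simp only [Matrix.of_apply]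
    rw [h2, Matrix.det_mul_column, Matrix.det_mul_row,
      det_integral_eq_integral_det (f := fun i j t =>
        Real.exp ((a i.succ + t * (a i.castSucc - a i.succ)) * d j)) (fun i j => by fun_prop)]
    simp only [h3]
    rw [Fin.prod_univ_succ, orbitalIntegral]
    simp only [mul_sub, Real.exp_sub, Real.exp_neg, div_eq_mul_inv, mul_assoc,
      integral_const_mul, mul_left_comm _ (∏ i, ∏ j ∈ Finset.Ioi i, (Fin.tail l i - Fin.tail l j))]
    simp only [Fin.Ioi_zero_eq_map, Finset.prod_map, Fin.coe_succEmb,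
      Fin.Ioi_succ, Fin.tail]
    ring

/-- The determinant and the Vandermonde product both change by `sign σ`; injectivity of `l` allows
dividing by the latter. -/
theorem orbitalIntegral_comp_perm {n : ℕ} (a : Fin n → ℝ) {l : Fin n → ℝ}
    (hl : Function.Injective l) (σ : Equiv.Perm (Fin n)) :
    orbitalIntegral n a (l ∘ σ) = orbitalIntegral n a l := by
  have hV : ∀ l : Fin n → ℝ, ∏ i, ∏ j ∈ Finset.Ioi i, (l i - l j) =
      Matrix.det (Matrix.vandermonde fun i => - l i) := by
    intro l
    simp only [Matrix.det_vandermonde]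
    refine Finset.prod_congr rfl fun i _ => Finset.prod_congr rfl fun j _ => by ring
  have h0 : Matrix.det (Matrix.vandermonde fun i => - l i) ≠ 0 :=
    Matrix.det_vandermonde_ne_zero_iff.mpr (neg_injective.comp hl)
  have h1 := Matrix.det_permute σ (Matrix.vandermonde fun i => - l i)
  have h2 := Matrix.det_permute' σ (Matrix.of fun i j => Real.exp (a i * l j))
  have h3 := det_exp_eq_orbitalIntegral n a l
  have h4 := det_exp_eq_orbitalIntegral n a (l ∘ σ)
  rw [hV] at h3 h4
  have h5 : (Matrix.vandermonde fun i => - l i).submatrix σ id =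
      Matrix.vandermonde fun i => - (l ∘ σ) i := rfl
  have h6 : (Matrix.of fun i j => Real.exp (a i * l j)).submatrix id σ =
      Matrix.of fun i j => Real.exp (a i * (l ∘ σ) j) := rfl
  rw [h5] at h1
  rw [h6, h4, h1, h3] at h2
  have hs : ((Equiv.Perm.sign σ : ℤ) : ℝ) ≠ 0 := by simp
  exact mul_left_cancel₀ (mul_ne_zero hs h0) (by linear_combination h2)

/-- Schur convexity of the orbital integral. -/
theorem orbitalIntegral_le_of_majorized {n : ℕ} {a l m : Fin n → ℝ} (ha : Antitone a)
    (hl : Antitone l) (hm : Function.Injective m) (h : Majorized l m) :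
    orbitalIntegral n a l ≤ orbitalIntegral n a m := by
  -- A convex function on a hull is bounded by its value at some generator, here a rearrangement of
  -- `m`.
  obtain ⟨_, ⟨σ, rfl⟩, hσ⟩ := ((convexOn_orbitalIntegral ha).subset
    (Set.subset_univ _) (convex_convexHull ℝ _)).exists_ge_of_mem_convexHull
    (subset_convexHull ℝ _) (h.mem_convexHull hl)
  exact hσ.trans_eq (orbitalIntegral_comp_perm a hm σ)

end NormalizedSchur

namespace NormalizedSchur

open MvPolynomial

/-! ### Normalized Schur polynomials as orbital integrals. -/

theorem strictAnti_staircase (n : ℕ) : StrictAnti (staircase n) := by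
  intro i j h
  have := j.isLt
  have : (i : ℕ) < j := h
  simp only [staircase]
  omega

/-- Each factor is `1 - X` times a polynomial with value `e i - e j` at `1`; this resolves the `0 /
0` in the specialization `X_i ↦ X ^ i` at `X = 1`. -/
theorem prod_powers_sub_eq {n : ℕ} {e : Fin n → ℕ} (he : StrictAnti e) :
    ∃ g : Polynomial ℝ, g.eval 1 = ∏ i, ∏ j ∈ Finset.Ioi i, ((e i : ℝ) - e j) ∧
      ∏ i : Fin n, ∏ j ∈ Finset.Ioi i, ((Polynomial.X : Polynomial ℝ) ^ e j -
        Polynomial.X ^ e i) =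
      (∏ i : Fin n, ∏ _j ∈ Finset.Ioi i, ((1 : Polynomial ℝ) - Polynomial.X)) * g := by
  refine ⟨∏ i : Fin n, ∏ j ∈ Finset.Ioi i, ((Polynomial.X : Polynomial ℝ) ^ e j *
    ∑ k ∈ Finset.range (e i - e j), Polynomial.X ^ k), ?_, ?_⟩
  · simp only [Polynomial.eval_prod]
    refine Finset.prod_congr rfl fun i _ => Finset.prod_congr rfl fun j hj => ?_
    have := he (Finset.mem_Ioi.mp hj)
    simp [Polynomial.eval_finsetSum, Nat.cast_sub this.le]
  · simp only [← Finset.prod_mul_distrib]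
    refine Finset.prod_congr rfl fun i _ => Finset.prod_congr rfl fun j hj => ?_
    have := he (Finset.mem_Ioi.mp hj)
    have h1 := mul_neg_geom_sum (Polynomial.X : Polynomial ℝ) (e i - e j)
    have h2 : (Polynomial.X : Polynomial ℝ) ^ e i =
        Polynomial.X ^ e j * Polynomial.X ^ (e i - e j) := by
      rw [← pow_add]; congr 1; omega
    rw [mul_left_comm, h1, h2]
    ring

/-- The Weyl dimension formula for `s_lam (1, …, 1)`. -/
theorem eval_one_schur {n : ℕ} {lam : Fin n → ℕ} (hlam : Antitone lam) :
    eval (1 : Fin n → ℝ) (schur lam) *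
        ∏ i, ∏ j ∈ Finset.Ioi i, ((staircase n i : ℝ) - staircase n j) =
      ∏ i, ∏ j ∈ Finset.Ioi i,
        (((lam i + staircase n i : ℕ) : ℝ) - (lam j + staircase n j : ℕ)) := by
  obtain ⟨g, hg, hg'⟩ := prod_powers_sub_eq (strictAnti_staircase n)
  obtain ⟨f, hf, hf'⟩ := prod_powers_sub_eq (hlam.add_strictAnti (strictAnti_staircase n))
  have h := congrArg (aeval (fun i : Fin n => (Polynomial.X : Polynomial ℝ) ^ (i : ℕ)))
    (schur_mul_alternant lam)
  rw [map_mul, aeval_alternant_powers, aeval_alternant_powers, hg'] at h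
  rw [hf', mul_left_comm] at h
  have hne : ∏ i : Fin n, ∏ _j ∈ Finset.Ioi i, ((1 : Polynomial ℝ) - Polynomial.X) ≠ 0 := by
    refine Finset.prod_ne_zero_iff.mpr fun i _ => Finset.prod_ne_zero_iff.mpr fun j hj => ?_
    intro h0
    have := congrArg (Polynomial.eval 0) h0
    simp at this
  have h2 := congrArg (Polynomial.eval 1) (mul_left_cancel₀ hne h)
  have h4 : (Polynomial.evalRingHom (1 : ℝ)).comp
      (aeval (R := ℝ) fun i : Fin n => (Polynomial.X : Polynomial ℝ) ^ (i : ℕ)).toRingHom =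
      eval (1 : Fin n → ℝ) := by
    apply MvPolynomial.ringHom_ext <;> intro r <;> simp
  have h3 : Polynomial.eval 1
      (aeval (fun i : Fin n => (Polynomial.X : Polynomial ℝ) ^ (i : ℕ)) (schur lam)) =
      eval (1 : Fin n → ℝ) (schur lam) :=
    congrArg (fun f : MvPolynomial (Fin n) ℝ →+* ℝ => f (schur lam)) h4
  rw [Polynomial.eval_mul, h3, hg, hf] at h2
  exact h2

theorem normalizedSchur_exp {n : ℕ} {lam : Fin n → ℕ} (hlam : Antitone lam) {a : Fin n → ℝ}
    (ha : StrictAnti a) :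
    normalizedSchur lam (fun i => Real.exp (a i)) =
      (∏ i, ∏ j ∈ Finset.Ioi i, ((staircase n i : ℝ) - staircase n j)) /
        (∏ i, ∏ j ∈ Finset.Ioi i, (Real.exp (a i) - Real.exp (a j))) *
        orbitalIntegral n a (fun j => ((lam j + staircase n j : ℕ) : ℝ)) := by
  have hD : 0 < ∏ i, ∏ j ∈ Finset.Ioi i, (Real.exp (a i) - Real.exp (a j)) :=
    Finset.prod_pos fun i _ => Finset.prod_pos fun j hj =>
      sub_pos.mpr (Real.exp_lt_exp.mpr (ha (Finset.mem_Ioi.mp hj)))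
  have h1 := congrArg (eval fun i => Real.exp (a i)) (schur_mul_alternant lam)
  have h2 : eval (fun i => Real.exp (a i)) (alternant (staircase n)) =
      ∏ i, ∏ j ∈ Finset.Ioi i, (Real.exp (a i) - Real.exp (a j)) := by
    simp [alternant_staircase, map_prod]
  have h3 := det_exp_eq_orbitalIntegral n a (fun j => ((lam j + staircase n j : ℕ) : ℝ))
  have h4 : (Matrix.of fun i j : Fin n => Real.exp (a i) ^ (lam j + staircase n j)) =
      Matrix.of fun i j => Real.exp (a i * ((lam j + staircase n j : ℕ) : ℝ)) := by
    ext i j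
    simp only [Matrix.of_apply]
    rw [mul_comm, Real.exp_nat_mul]
  rw [map_mul, h2, eval_alternant, h4, h3, ← eval_one_schur hlam] at h1
  have hs := eval_one_schur_pos hlam
  rw [normalizedSchur, div_eq_iff hs.ne', div_mul_eq_mul_div, div_mul_eq_mul_div,
    eq_div_iff hD.ne', h1]
  ring

/-- Both determinants in the quotient acquire the factor `sign σ`. -/
theorem normalizedSchur_comp_perm {n : ℕ} (lam : Fin n → ℕ) {x : Fin n → ℝ}
    (hx : Function.Injective x) (σ : Equiv.Perm (Fin n)) :
    normalizedSchur lam (x ∘ σ) = normalizedSchur lam x := by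
  have h := fun e : Fin n → ℕ => Matrix.det_permute σ (Matrix.of fun i j : Fin n => x i ^ e j)
  have h1 := h fun j => lam j + (n - 1 - (j : ℕ))
  have h2 := h fun j => n - 1 - (j : ℕ)
  have hs : ((Equiv.Perm.sign σ : ℤ) : ℝ) ≠ 0 := by simp
  rw [normalizedSchur, normalizedSchur, eval_schur lam hx,
    eval_schur lam (hx.comp σ.injective)]
  congr 1
  symm
  rw [← mul_div_mul_left _ _ hs, ← h1, ← h2]
  rfl

theorem Majorized.add_right {n : ℕ} {a b : Fin n → ℝ} (h : Majorized a b) (c : Fin n → ℝ) :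
    Majorized (fun i => a i + c i) fun i => b i + c i := by
  refine ⟨fun k hk hk' => ?_, ?_⟩
  · simpa [Finset.sum_add_distrib] using h.1 k hk hk'
  · simpa [Finset.sum_add_distrib] using h.2

theorem normalizedSchur_le_of_strictAnti {n : ℕ} {lam mu : Fin n → ℕ} (hlam : Antitone lam)
    (hmu : Antitone mu) (h : Majorized (fun i => (lam i : ℝ)) fun i => (mu i : ℝ))
    {y : Fin n → ℝ} (hy : StrictAnti y) (hpos : ∀ i, 0 < y i) :
    normalizedSchur lam y ≤ normalizedSchur mu y := by
  obtain ⟨a, rfl⟩ : ∃ a : Fin n → ℝ, y = fun i => Real.exp (a i) :=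
    ⟨fun i => Real.log (y i), funext fun i => (Real.exp_log (hpos i)).symm⟩
  have ha : StrictAnti a := fun i j hij => Real.exp_lt_exp.mp (hy hij)
  rw [normalizedSchur_exp hlam ha, normalizedSchur_exp hmu ha]
  have hst := strictAnti_staircase n
  refine mul_le_mul_of_nonneg_left (orbitalIntegral_le_of_majorized ha.antitone ?_ ?_ ?_) ?_
  · exact fun i j hij => Nat.cast_le.mpr (hlam.add_strictAnti hst |>.antitone hij)
  · exact Nat.cast_injective.comp (hmu.add_strictAnti hst).injective
  · simpa only [Nat.cast_add] using h.add_right fun i => (staircase n i : ℝ)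
  · refine div_nonneg ?_ ?_ <;>
      refine Finset.prod_nonneg fun i _ => Finset.prod_nonneg fun j hj => sub_nonneg.mpr ?_
    · exact Nat.cast_le.mpr (hst (Finset.mem_Ioi.mp hj)).le
    · exact (hy (Finset.mem_Ioi.mp hj)).le

theorem continuous_normalizedSchur {n : ℕ} (lam : Fin n → ℕ) :
    Continuous (normalizedSchur lam) :=
  (MvPolynomial.continuous_eval _).div_const _

end NormalizedSchur

/-! ### Passage to arbitrary nonnegative arguments. -/

theorem theorem1 (n : ℕ) (lam mu : Fin n → ℕ) (hlam : Antitone lam) (hmu : Antitone mu)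
    (hmaj : NormalizedSchur.Majorized (fun i => (lam i : ℝ)) (fun i => (mu i : ℝ)))
    (x : Fin n → ℝ) (hx : ∀ i, 0 ≤ x i) :
    NormalizedSchur.normalizedSchur lam x ≤ NormalizedSchur.normalizedSchur mu x := by
  set σ := Tuple.sort fun i => - x i
  have hσ : Antitone (x ∘ σ) := by
    intro i j hij
    have := Tuple.monotone_sort (fun i => - x i) hij
    simpa using this
  -- Here `σ⁻¹ i` is the position of `x i` in decreasing order. The added terms break ties without
  -- disturbing that order, and stay positive since `σ⁻¹ i < n`, so zero entries become positive
  -- too.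
  set y : ℝ → Fin n → ℝ := fun ε i => x i + ε * ((n : ℝ) - (σ⁻¹ i : Fin n)) with hy
  have hle : ∀ ε > 0, NormalizedSchur.normalizedSchur lam (y ε) ≤
      NormalizedSchur.normalizedSchur mu (y ε) := by
    intro ε hε
    have hanti : StrictAnti (y ε ∘ σ) := by
      intro i j hij
      have h1 := hσ hij.le
      have h2 : ((i : ℕ) : ℝ) < (j : ℕ) := Nat.cast_lt.mpr hij
      simp only [Function.comp_apply] at h1
      simp only [hy, Function.comp_apply, Equiv.Perm.coe_inv, Equiv.symm_apply_apply]
      nlinarith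
    have hinj : Function.Injective (y ε) := by
      have := hanti.injective.comp (σ⁻¹).injective
      simpa [Function.comp_def] using this
    have hpos : ∀ i, 0 < (y ε ∘ σ) i := by
      intro i
      have h2 : ((i : ℕ) : ℝ) < n := Nat.cast_lt.mpr i.isLt
      simp only [hy, Function.comp_apply, Equiv.Perm.coe_inv, Equiv.symm_apply_apply]
      have := mul_pos hε (sub_pos.mpr h2)
      linarith [hx (σ i)]
    rw [← NormalizedSchur.normalizedSchur_comp_perm lam hinj σ,
      ← NormalizedSchur.normalizedSchur_comp_perm mu hinj σ]
    exact NormalizedSchur.normalizedSchur_le_of_strictAnti hlam hmu hmaj hanti hpos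
  have hyc : Continuous y := by
    simp only [hy]
    fun_prop
  have hy0 : y 0 = x := by simp [hy]
  have hlim : ∀ nu : Fin n → ℕ, Filter.Tendsto (fun ε => NormalizedSchur.normalizedSchur nu (y ε))
      (nhdsWithin 0 (Set.Ioi 0)) (nhds (NormalizedSchur.normalizedSchur nu x)) := by
    intro nu
    have := ((NormalizedSchur.continuous_normalizedSchur nu).comp hyc).tendsto 0
    rw [Function.comp_apply, hy0] at this
    exact this.mono_left nhdsWithin_le_nhds
  exact le_of_tendsto_of_tendsto (hlim lam) (hlim mu)
    (Filter.eventually_of_mem self_mem_nhdsWithin hle)
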